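/- Consider the two-stage General Lotto game with pre-allocations on $n$ battlefields with values $w_1,\dots,w_n>0$, $\sum_b w_b=1$. In Stage 1, player $A$ chooses $\boldsymbol p\in\Delta_n(P)=\{\boldsymbol p\in\mathbb R_{\ge 0}^n:\sum_b p_b=P\}$, which both players observe. In Stage 2, each player $i\in\{A,B\}$ simultaneously chooses a probability distribution $F_i$ on $\mathbb R_{\ge0}^n$ with $\mathbb E_{x_i\sim F_i}[\sum_b x_{i,b}]\le R_i$. The payoff of $A$ is $U_A=\mathbb E[\sum_b w_b s_b]$ with $x_A\sim F_A$ and $x_B\sim F_B$ independent, where $s_b=1$ if $x_{A,b}+p_b>x_{B,b}$, $s_b=0$ if $x_{A,b}+p_b<x_{B,b}$, and at a tie $s_b=\tau_b$ for a fixed tie-breaking rule $\tau\in[0,1]^n$; the payoff of $B$ is $U_B=1-U_A$. A subgame-perfect equilibrium (SPE) consists of $\boldsymbol p^*\in\Delta_n(P)$ and, for every $\boldsymbol p\in\Delta_n(P)$, a Nash equilibrium $(F_A^*(\boldsymbol p),F_B^*(\boldsymbol p))$ of Stage 2 after $\boldsymbol p$, such that $\boldsymbol p^*$ maximizes $U_A(\boldsymbol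 p,F_A^*(\boldsymbol p),F_B^*(\boldsymbol p))$ over $\Delta_n(P)$. Fix $R_B>0$ and $\Pi\in[0,1]$. 1. If ties are won by $B$ ($\tau=0$), then for all $P,R_A\ge0$ an SPE exists and all SPEs give $A$ the same payoff, denoted $\pi_A^*(P,R_A,R_B)$. 2. Let $L_\Pi=\{(P,R_A)\in\mathbb R_{\ge0}^2:\pi_A^*(P,R_A,R_B)=\Pi\}$. If $\Pi<1$, then $$L_\Pi=\Big\{(P,R_\Pi(P)):P\in\Big[0,\tfrac{R_B}{1-\Pi}\Big]\Big\},$$ where, for $0\le\Pi<\tfrac12$, $$R_\Pi(P)=\begin{cases}2\Pi(R_B-P),&0\le P<\frac{(1-2\Pi)R_B}{1-\Pi},\\[2pt] \frac{(R_B-(1-\Pi)P)^2}{2R_B(1-\Pi)},&\frac{(1-2\Pi)R_B}{1-\Pi}\le P\le\frac{R_B}{1-\Pi},\end{cases}$$ and, for $\tfrac12\le\Pi<1$, $R_\Pi(P)=\frac{(R_B-(1-\Pi)P)^2}{2R_B(1-\Pi)}$ for all $P\in[0,\frac{R_B}{1-\Pi}]$. If $P>\frac{R_B}{1-\Pi}$,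 then $\pi_A^*(P,R_A,R_B)>\Pi$ for every $R_A\ge0$. If $\Pi=1$, then $L_\Pi=\emptyset$. 3. The tie-breaking rule is immaterial: for every $\tau\in[0,1]^n$ and all $P,R_A\ge0$, an SPE exists whenever $R_A>0$ or $P<R_B$, and whenever an SPE exists, $A$'s payoff in it is the same number $\pi_A^*(P,R_A,R_B)$. -/

import Mathlib

open MeasureTheory

/-- The strategies of a player with real-time budget `R`: probability distributions over
nonnegative allocations to the `n` battlefields whose expected total expenditure is at most `R`. -/
def lottoStrategies (n : ℕ) (R : ℝ) : Set (Measure (Fin n → ℝ)) :=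
  {F | IsProbabilityMeasure F ∧ (∀ᵐ x ∂F, ∀ b, 0 ≤ x b) ∧
    ∫⁻ x, ∑ b, ENNReal.ofReal (x b) ∂F ≤ ENNReal.ofReal R}

/-- The feasible pre-allocation profiles: nonnegative vectors with total `P`. -/
def preallocations (n : ℕ) (P : ℝ) : Set (Fin n → ℝ) :=
  {p | (∀ b, 0 ≤ p b) ∧ ∑ b, p b = P}

/-- The fraction of a battlefield won by player `A` when `A` has the total `a` on it and `B` has
the amount `c`; `t` is the fraction that `A` receives at a tie. -/
noncomputable def winShare (t a c : ℝ) : ℝ :=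
  if c < a then 1 else if a = c then t else 0

/-- The expected payoff of player `A` in the final stage, for independent strategies `FA`, `FB`.
The tie-breaking rule `τ` gives the fraction `τ b` of battlefield `b` to player `A` at a tie;
`τ = 1` is the indicator of `x_{A,b} + p_b ≥ x_{B,b}`, `τ = 0` that of the strict inequality. -/
noncomputable def payoffA {n : ℕ} (τ w p : Fin n → ℝ) (FA FB : Measure (Fin n → ℝ)) : ℝ :=
  ∫ x, ∑ b, w b * winShare (τ b) (x.1 b + p b) (x.2 b) ∂(FA.prod FB)

/-- The expected payoff of player `B` (the battlefield values add up to one). -/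
noncomputable def payoffB {n : ℕ} (τ w p : Fin n → ℝ) (FA FB : Measure (Fin n → ℝ)) : ℝ :=
  1 - payoffA τ w p FA FB

/-- Nash equilibria of the final-stage subgame after the pre-allocation `p`. -/
def IsSubgameNash {n : ℕ} (τ w p : Fin n → ℝ) (RA RB : ℝ) (FA FB : Measure (Fin n → ℝ)) : Prop :=
  FA ∈ lottoStrategies n RA ∧ FB ∈ lottoStrategies n RB ∧
  (∀ F ∈ lottoStrategies n RA, payoffA τ w p F FB ≤ payoffA τ w p FA FB) ∧
  (∀ F ∈ lottoStrategies n RB, payoffB τ w p FA F ≤ payoffB τ w p FA FB)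

/-- Subgame-perfect equilibria `(p*, FA*(·), FB*(·))` of the two-stage game. -/
def IsSPE {n : ℕ} (τ w : Fin n → ℝ) (P RA RB : ℝ) (pstar : Fin n → ℝ)
    (FA FB : (Fin n → ℝ) → Measure (Fin n → ℝ)) : Prop :=
  pstar ∈ preallocations n P ∧
  (∀ p ∈ preallocations n P, IsSubgameNash τ w p RA RB (FA p) (FB p)) ∧
  (∀ p ∈ preallocations n P,
    payoffA τ w p (FA p) (FB p) ≤ payoffA τ w pstar (FA pstar) (FB pstar))

/-- `v` is the payoff of player `A` in a subgame-perfect equilibrium. -/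
def IsSPEPayoffA {n : ℕ} (τ w : Fin n → ℝ) (P RA RB v : ℝ) : Prop :=
  ∃ (pstar : Fin n → ℝ) (FA FB : (Fin n → ℝ) → Measure (Fin n → ℝ)),
    IsSPE τ w P RA RB pstar FA FB ∧ payoffA τ w pstar (FA pstar) (FB pstar) = v

/-- The level curve of performance level `c`: the pairs `(P, R_A)` of nonnegative reals for which
the subgame-perfect equilibrium payoff of player `A` is `c`. -/
def levelCurve {n : ℕ} (τ w : Fin n → ℝ) (RB c : ℝ) : Set (ℝ × ℝ) :=
  {q | 0 ≤ q.1 ∧ 0 ≤ q.2 ∧ IsSPEPayoffA τ w q.1 q.2 RB c}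

/-- The function whose graph is the level curve of performance level `c < 1`. -/
noncomputable def levelFn (RB c P : ℝ) : ℝ :=
  if c < 1 / 2 ∧ P < (1 - 2 * c) * RB / (1 - c) then 2 * c * (RB - P)
  else (RB - (1 - c) * P) ^ 2 / (2 * RB * (1 - c))

/-!
Both players may bid uniformly: with `u` uniform on `[0, 1]`, a bid affine in `u` on `[0, k b]` and
zero elsewhere makes the winning probability on a battlefield at least (or at most) affine in the
opponent's bid, so that only the opponent's expected total expenditure matters. The best such bids
of `A` and `B` are the two sides of a saddle point of a function that is affine in `B`'s contest
probabilities and in `A`'s bid depths and cost multiplier; Sion's minimax theorem provides one, and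
hence a Nash equilibrium of the subgame; the tie-breaking rule can only interfere if `A` has nothing
to bid.

The subgame is constant-sum, so the equilibrium payoff is bounded by what either player can
guarantee. Contesting every battlefield with the same probability lets `B` hold `A` to a bound that
does not depend on the pre-allocation, and the pre-allocation proportional to the values lets `A`
secure the optimum of that bound. This pins down the payoff of every subgame-perfect equilibrium in
closed form, whatever the tie-breaking rule, and the level curves are obtained by inverting the
closed form.
-/

section Payoff

variable {n : ℕ} {τ w p : Fin n → ℝ} {FA FB : Measure (Fin n → ℝ)}
  {Ω : Type*} [MeasurableSpace Ω] {μ : Measure Ω}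

lemma winShare_of_lt {t a c : ℝ} (h : c < a) : winShare t a c = 1 := by
  simp [winShare, h]

lemma winShare_of_gt {t a c : ℝ} (h : a < c) : winShare t a c = 0 := by
  simp [winShare, h.not_gt, h.ne]

lemma winShare_nonneg {t : ℝ} (ht : 0 ≤ t) (a c : ℝ) : 0 ≤ winShare t a c := by
  unfold winShare
  split_ifs
  exacts [zero_le_one, ht, le_rfl]

lemma winShare_le_one {t : ℝ} (ht : t ≤ 1) (a c : ℝ) : winShare t a c ≤ 1 := by
  unfold winShare
  split_ifs
  exacts [le_rfl, ht, zero_le_one]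

lemma abs_winShare_le (t a c : ℝ) : |winShare t a c| ≤ max 1 |t| := by
  unfold winShare
  split_ifs <;> simp

lemma measurable_winShare (t : ℝ) {f g : Ω → ℝ} (hf : Measurable f) (hg : Measurable g) :
    Measurable fun ω => winShare t (f ω) (g ω) :=
  Measurable.ite (measurableSet_lt hg hf) measurable_const
    (Measurable.ite (measurableSet_eq_fun hf hg) measurable_const measurable_const)

lemma integrable_winShare [IsFiniteMeasure μ] (t : ℝ) {f g : Ω → ℝ} (hf : Measurable f)
    (hg : Measurable g) : Integrable (fun ω => winShare t (f ω) (g ω)) μ :=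
  Integrable.of_bound (measurable_winShare t hf hg).aestronglyMeasurable (max 1 |t|)
    (Filter.Eventually.of_forall fun _ => abs_winShare_le t _ _)

lemma measureReal_le_integral_winShare [IsFiniteMeasure μ] {t : ℝ} (ht : 0 ≤ t) {f g : Ω → ℝ}
    (hf : Measurable f) (hg : Measurable g) {S : Set Ω} (hS : MeasurableSet S)
    (hwin : ∀ ω ∈ S, g ω < f ω) : μ.real S ≤ ∫ ω, winShare t (f ω) (g ω) ∂μ := by
  rw [← integral_indicator_one hS]
  refine integral_mono ((integrable_const 1).indicator hS) (integrable_winShare t hf hg)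
    fun ω => ?_
  by_cases hω : ω ∈ S
  · simp [hω, winShare_of_lt (hwin ω hω)]
  · simpa [hω] using winShare_nonneg ht _ _

lemma integral_winShare_le_one_sub_measureReal [IsProbabilityMeasure μ] {t : ℝ} (ht : t ≤ 1)
    {f g : Ω → ℝ} (hf : Measurable f) (hg : Measurable g) {S : Set Ω} (hS : MeasurableSet S)
    (hlose : ∀ ω ∈ S, winShare t (f ω) (g ω) = 0) :
    ∫ ω, winShare t (f ω) (g ω) ∂μ ≤ 1 - μ.real S := by
  rw [← probReal_compl_eq_one_sub hS, ← integral_indicator_one hS.compl]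
  refine integral_mono (integrable_winShare t hf hg) ((integrable_const 1).indicator hS.compl)
    fun ω => ?_
  by_cases hω : ω ∈ S
  · simp [hω, hlose ω hω]
  · simpa [hω] using winShare_le_one ht _ _

/-- The total value won by player `A` when the players use the pure strategies `x` and `y`, that
is, the integrand of `payoffA`. -/
noncomputable def totalShare {n : ℕ} (τ w p x y : Fin n → ℝ) : ℝ :=
  ∑ b, w b * winShare (τ b) (x b + p b) (y b)

lemma integrable_totalShare [IsFiniteMeasure μ] {f g : Ω → Fin n → ℝ} (hf : Measurable f)
    (hg : Measurable g) : Integrable (fun ω => totalShare τ w p (f ω) (g ω)) μ :=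
  integrable_finsetSum _ fun b _ =>
    (integrable_winShare (τ b) (by fun_prop) (by fun_prop)).const_mul (w b)

lemma integral_totalShare [IsFiniteMeasure μ] {f g : Ω → Fin n → ℝ} (hf : Measurable f)
    (hg : Measurable g) :
    ∫ ω, totalShare τ w p (f ω) (g ω) ∂μ =
      ∑ b, w b * ∫ ω, winShare (τ b) (f ω b + p b) (g ω b) ∂μ := by
  simp_rw [totalShare, ← integral_const_mul]
  exact integral_finsetSum _ fun b _ =>
    (integrable_winShare (τ b) (by fun_prop) (by fun_prop)).const_mul (w b)

lemma payoffA_nonneg (hw : ∀ b, 0 ≤ w b) (hτ : ∀ b, 0 ≤ τ b)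
    (FA FB : Measure (Fin n → ℝ)) : 0 ≤ payoffA τ w p FA FB :=
  integral_nonneg fun _ => Finset.sum_nonneg fun b _ =>
    mul_nonneg (hw b) (winShare_nonneg (hτ b) _ _)

lemma payoffA_eq_integral_integral [IsFiniteMeasure FA] [IsFiniteMeasure FB] :
    payoffA τ w p FA FB = ∫ x, ∫ y, totalShare τ w p x y ∂FB ∂FA :=
  integral_prod _ (integrable_totalShare measurable_fst measurable_snd)

lemma payoffA_eq_integral_integral_symm [IsFiniteMeasure FA] [IsFiniteMeasure FB] :
    payoffA τ w p FA FB = ∫ y, ∫ x, totalShare τ w p x y ∂FA ∂FB :=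
  integral_prod_symm _ (integrable_totalShare measurable_fst measurable_snd)

end Payoff

section Strategies

variable {n : ℕ} {τ w p : Fin n → ℝ} {R RA RB v : ℝ} {F FA FB : Measure (Fin n → ℝ)}
  {Ω : Type*} [MeasurableSpace Ω] {μ : Measure Ω}

lemma integrable_sum_of_mem_lottoStrategies (hF : F ∈ lottoStrategies n R) :
    Integrable (fun x => ∑ b, x b) F := by
  obtain ⟨_, hnonneg, hcost⟩ := hF
  refine ⟨by fun_prop, ?_⟩
  rw [hasFiniteIntegral_iff_ofReal
    (by filter_upwards [hnonneg] with x hx using Finset.sum_nonneg fun b _ => hx b)]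
  calc ∫⁻ x, ENNReal.ofReal (∑ b, x b) ∂F = ∫⁻ x, ∑ b, ENNReal.ofReal (x b) ∂F :=
        lintegral_congr_ae <| by
          filter_upwards [hnonneg] with x hx using ENNReal.ofReal_sum_of_nonneg fun b _ => hx b
    _ < ⊤ := hcost.trans_lt ENNReal.ofReal_lt_top

lemma integral_sum_le_of_mem_lottoStrategies (hR : 0 ≤ R) (hF : F ∈ lottoStrategies n R) :
    ∫ x, ∑ b, x b ∂F ≤ R := by
  have hint := integrable_sum_of_mem_lottoStrategies hF
  obtain ⟨_, hnonneg, hcost⟩ := hF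
  rw [integral_eq_lintegral_of_nonneg_ae
    (by filter_upwards [hnonneg] with x hx using Finset.sum_nonneg fun b _ => hx b) hint.1]
  refine ENNReal.toReal_le_of_le_ofReal hR (le_trans (lintegral_mono_ae ?_) hcost)
  filter_upwards [hnonneg] with x hx using
    (ENNReal.ofReal_sum_of_nonneg fun b _ => hx b).le

lemma integral_le_of_mem_lottoStrategies {C l : ℝ} (hR : 0 ≤ R) (hl : 0 ≤ l)
    (hF : F ∈ lottoStrategies n R) {g : (Fin n → ℝ) → ℝ} (hg : Integrable g F)
    (h : ∀ x, (∀ b, 0 ≤ x b) → g x ≤ C + l * ∑ b, x b) : ∫ x, g x ∂F ≤ C + l * R := by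
  have hint := integrable_sum_of_mem_lottoStrategies hF
  have hcost := integral_sum_le_of_mem_lottoStrategies hR hF
  obtain ⟨_, hnonneg, -⟩ := hF
  calc ∫ x, g x ∂F ≤ ∫ x, (C + l * ∑ b, x b) ∂F :=
        integral_mono_ae hg ((integrable_const C).add (hint.const_mul l)) <| by
          filter_upwards [hnonneg] with x hx using h x hx
    _ = C + l * ∫ x, ∑ b, x b ∂F := by
        rw [integral_add (integrable_const C) (hint.const_mul l), integral_const_mul]
        simp
    _ ≤ C + l * R := by gcongr

lemma payoffA_le_of_integral_winShare_le [IsFiniteMeasure FB] {C : Fin n → ℝ} {l : ℝ}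
    (hRA : 0 ≤ RA) (hl : 0 ≤ l) (hFA : FA ∈ lottoStrategies n RA)
    (h : ∀ b x, 0 ≤ x → w b * ∫ y, winShare (τ b) (x + p b) (y b) ∂FB ≤ C b + l * x) :
    payoffA τ w p FA FB ≤ ∑ b, C b + l * RA := by
  have := hFA.1
  have hint := integrable_totalShare (τ := τ) (w := w) (p := p) (μ := FA.prod FB)
    measurable_fst measurable_snd
  rw [payoffA_eq_integral_integral]
  refine integral_le_of_mem_lottoStrategies hRA hl hFA hint.integral_prod_left fun x hx => ?_
  calc ∫ y, totalShare τ w p x y ∂FB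
      = ∑ b, w b * ∫ y, winShare (τ b) (x b + p b) (y b) ∂FB :=
        integral_totalShare measurable_const measurable_id
    _ ≤ ∑ b, (C b + l * x b) := Finset.sum_le_sum fun b _ => h b (x b) (hx b)
    _ = ∑ b, C b + l * ∑ b, x b := by rw [Finset.sum_add_distrib, Finset.mul_sum]

lemma le_payoffA_of_le_integral_winShare [IsFiniteMeasure FA] {C : Fin n → ℝ} {l : ℝ}
    (hRB : 0 ≤ RB) (hl : 0 ≤ l) (hFB : FB ∈ lottoStrategies n RB)
    (h : ∀ b y, 0 ≤ y → C b - l * y ≤ w b * ∫ x, winShare (τ b) (x b + p b) y ∂FA) :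
    ∑ b, C b - l * RB ≤ payoffA τ w p FA FB := by
  have := hFB.1
  have hint := integrable_totalShare (τ := τ) (w := w) (p := p) (μ := FA.prod FB)
    measurable_fst measurable_snd
  suffices -payoffA τ w p FA FB ≤ -∑ b, C b + l * RB by linarith
  rw [payoffA_eq_integral_integral_symm, ← integral_neg]
  refine integral_le_of_mem_lottoStrategies hRB hl hFB hint.integral_prod_right.neg
    fun y hy => neg_le.2 ?_
  calc -(-∑ b, C b + l * ∑ b, y b) = ∑ b, (C b - l * y b) := by
        rw [Finset.sum_sub_distrib, Finset.mul_sum]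
        ring
    _ ≤ ∑ b, w b * ∫ x, winShare (τ b) (x b + p b) (y b) ∂FA :=
        Finset.sum_le_sum fun b _ => h b (y b) (hy b)
    _ = ∫ x, totalShare τ w p x y ∂FA :=
        (integral_totalShare measurable_id measurable_const).symm

lemma ae_eq_zero_of_mem_lottoStrategies_zero (hF : F ∈ lottoStrategies n 0) :
    ∀ᵐ x ∂F, x = 0 := by
  obtain ⟨_, hnonneg, hcost⟩ := hF
  rw [ENNReal.ofReal_zero, nonpos_iff_eq_zero, lintegral_eq_zero_iff (by fun_prop)] at hcost
  filter_upwards [hnonneg, hcost] with x hx hzero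
  have hle : ∀ b, x b ≤ 0 := by simpa using hzero
  exact funext fun b => (hle b).antisymm (hx b)

lemma payoffA_eq_of_mem_lottoStrategies_zero [IsFiniteMeasure FB]
    (hFA : FA ∈ lottoStrategies n 0) :
    payoffA τ w p FA FB = ∑ b, w b * ∫ y, winShare (τ b) (p b) (y b) ∂FB := by
  have := hFA.1
  calc payoffA τ w p FA FB = ∫ x, ∫ y, totalShare τ w p x y ∂FB ∂FA :=
        payoffA_eq_integral_integral
    _ = ∫ _, ∫ y, totalShare τ w p 0 y ∂FB ∂FA := integral_congr_ae <| by
        filter_upwards [ae_eq_zero_of_mem_lottoStrategies_zero hFA] with x hx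
        rw [hx]
    _ = ∫ y, totalShare τ w p 0 y ∂FB := by simp
    _ = _ := by
        simpa using integral_totalShare (μ := FB) (τ := τ) (w := w) (p := p)
          (measurable_const (a := (0 : Fin n → ℝ))) measurable_id

/-- Player `A` can secure at least `v` in the subgame after `p`, whatever `B` does. -/
def IsSecuredByA {n : ℕ} (τ w p : Fin n → ℝ) (RA RB v : ℝ) : Prop :=
  ∃ FA ∈ lottoStrategies n RA, ∀ FB ∈ lottoStrategies n RB, v ≤ payoffA τ w p FA FB

/-- Player `B` can hold `A` down to at most `v` in the subgame after `p`, whatever `A` does. -/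
def IsCappedByB {n : ℕ} (τ w p : Fin n → ℝ) (RA RB v : ℝ) : Prop :=
  ∃ FB ∈ lottoStrategies n RB, ∀ FA ∈ lottoStrategies n RA, payoffA τ w p FA FB ≤ v

lemma IsSecuredByA.mono {v' : ℝ} (h : IsSecuredByA τ w p RA RB v) (hv : v' ≤ v) :
    IsSecuredByA τ w p RA RB v' :=
  h.imp fun _ hFA => ⟨hFA.1, fun FB hFB => hv.trans (hFA.2 FB hFB)⟩

lemma IsCappedByB.mono {v' : ℝ} (h : IsCappedByB τ w p RA RB v) (hv : v ≤ v') :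
    IsCappedByB τ w p RA RB v' :=
  h.imp fun _ hFB => ⟨hFB.1, fun FA hFA => (hFB.2 FA hFA).trans hv⟩

lemma exists_isSubgameNash (hA : IsSecuredByA τ w p RA RB v) (hB : IsCappedByB τ w p RA RB v) :
    ∃ FA FB, IsSubgameNash τ w p RA RB FA FB := by
  obtain ⟨FA, hFA, hsecured⟩ := hA
  obtain ⟨FB, hFB, hcapped⟩ := hB
  exact ⟨FA, FB, hFA, hFB, fun F hF => (hcapped F hF).trans (hsecured FB hFB),
    fun F hF => sub_le_sub_left ((hcapped FA hFA).trans (hsecured F hF)) 1⟩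

lemma IsSubgameNash.le_payoffA (h : IsSubgameNash τ w p RA RB FA FB)
    (hv : IsSecuredByA τ w p RA RB v) : v ≤ payoffA τ w p FA FB := by
  obtain ⟨F, hF, hsecured⟩ := hv
  exact (hsecured FB h.2.1).trans (h.2.2.1 F hF)

lemma IsSubgameNash.payoffA_le (h : IsSubgameNash τ w p RA RB FA FB)
    (hv : IsCappedByB τ w p RA RB v) : payoffA τ w p FA FB ≤ v := by
  obtain ⟨F, hF, hcapped⟩ := hv
  exact ((sub_le_sub_iff_left 1).1 (h.2.2.2 F hF)).trans (hcapped FA h.1)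

lemma isSecuredByA_zero (hw : ∀ b, 0 ≤ w b) (hτ : ∀ b, 0 ≤ τ b) :
    IsSecuredByA τ w p RA RB 0 :=
  ⟨Measure.dirac 0, ⟨inferInstance, by simp [ae_dirac_eq], by simp⟩,
    fun FB _ => payoffA_nonneg hw hτ _ FB⟩

end Strategies

section UniformBids

/-- The uniform distribution on the unit interval. -/
noncomputable def unitUniform : Measure ℝ := volume.restrict (Set.Ioc 0 1)

instance : IsProbabilityMeasure unitUniform := ⟨by simp [unitUniform]⟩

lemma ae_unitUniform_pos : ∀ᵐ u ∂unitUniform, 0 < u :=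
  (ae_restrict_mem measurableSet_Ioc).mono fun _ hu => hu.1

lemma le_unitUniform_real_Ioo {a b : ℝ} (ha : 0 ≤ a) (hb : b ≤ 1) :
    b - a ≤ unitUniform.real (Set.Ioo a b) := by
  have hsub : Set.Ioo a b ⊆ Set.Ioc 0 1 := fun u hu => ⟨ha.trans_lt hu.1, hu.2.le.trans hb⟩
  rw [unitUniform, measureReal_restrict_apply measurableSet_Ioo, Set.inter_eq_left.2 hsub,
    Real.volume_real_Ioo]
  exact le_max_left _ _

/-- The allocation bidding `c b + d b * u` on battlefield `b` if `u ≤ k b`, and nothing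
otherwise; both players randomize by taking `u` uniform on the unit interval. -/
noncomputable def rampBid {n : ℕ} (k c d : Fin n → ℝ) (u : ℝ) (b : Fin n) : ℝ :=
  if u ≤ k b then c b + d b * u else 0

/-- The mixed strategy `rampBid k c d u` for a uniform `u`. -/
noncomputable def rampStrategy {n : ℕ} (k c d : Fin n → ℝ) : Measure (Fin n → ℝ) :=
  unitUniform.map (rampBid k c d)

variable {n : ℕ} {k c d : Fin n → ℝ}

lemma measurable_rampBid_apply (b : Fin n) : Measurable fun u => rampBid k c d u b :=
  Measurable.ite measurableSet_Iic (by fun_prop) measurable_const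

lemma measurable_rampBid : Measurable (rampBid k c d) :=
  measurable_pi_lambda _ measurable_rampBid_apply

instance : IsProbabilityMeasure (rampStrategy k c d) :=
  Measure.isProbabilityMeasure_map measurable_rampBid.aemeasurable

lemma integrable_rampBid (b : Fin n) : Integrable (fun u => rampBid k c d u b) unitUniform := by
  have hint : IntegrableOn (fun u => c b + d b * u) (Set.Ioc 0 1) :=
    (by fun_prop : Continuous fun u => c b + d b * u).integrableOn_Ioc
  exact hint.indicator (measurableSet_Iic (a := k b))

lemma integral_rampBid {b : Fin n} (hk : k b ∈ Set.Icc (0 : ℝ) 1) :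
    ∫ u, rampBid k c d u b ∂unitUniform = c b * k b + d b * k b ^ 2 / 2 := by
  calc ∫ u, rampBid k c d u b ∂unitUniform
      = ∫ u, (Set.Iic (k b)).indicator (fun u => c b + d b * u) u ∂unitUniform := rfl
    _ = ∫ u in (0)..(k b), (c b + d b * u) := by
        rw [integral_indicator measurableSet_Iic, unitUniform,
          Measure.restrict_restrict measurableSet_Iic, Set.Iic_inter_Ioc_of_le hk.2,
           intervalIntegral.integral_of_le hk.1]
    _ = c b * k b + d b * k b ^ 2 / 2 := by
        rw [intervalIntegral.integral_add (by simp)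
          ((continuous_const_mul (d b)).intervalIntegrable _ _),
          intervalIntegral.integral_const, intervalIntegral.integral_const_mul, integral_id,
          smul_eq_mul]
        ring

lemma rampStrategy_mem_lottoStrategies {R : ℝ} (hk : ∀ b, k b ∈ Set.Icc (0 : ℝ) 1)
    (hnonneg : ∀ b u, 0 ≤ u → u ≤ k b → 0 ≤ c b + d b * u)
    (hcost : ∑ b, (c b * k b + d b * k b ^ 2 / 2) ≤ R) :
    rampStrategy k c d ∈ lottoStrategies n R := by
  have hbid : ∀ᵐ u ∂unitUniform, ∀ b, 0 ≤ rampBid k c d u b := by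
    filter_upwards [ae_unitUniform_pos] with u hu b
    unfold rampBid
    split_ifs with hub
    exacts [hnonneg b u hu.le hub, le_rfl]
  have hmeas := measurable_rampBid (k := k) (c := c) (d := d)
  refine ⟨inferInstance, ?_, ?_⟩
  · have hset : MeasurableSet {x : Fin n → ℝ | ∀ b, 0 ≤ x b} := measurableSet_Ici (a := 0)
    exact (ae_map_iff hmeas.aemeasurable hset).2 hbid
  · calc ∫⁻ x, ∑ b, ENNReal.ofReal (x b) ∂rampStrategy k c d
        = ∫⁻ u, ∑ b, ENNReal.ofReal (rampBid k c d u b) ∂unitUniform :=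
          lintegral_map (by fun_prop) hmeas
      _ = ∫⁻ u, ENNReal.ofReal (∑ b, rampBid k c d u b) ∂unitUniform := lintegral_congr_ae <| by
          filter_upwards [hbid] with u hu using
            (ENNReal.ofReal_sum_of_nonneg fun b _ => hu b).symm
      _ = ENNReal.ofReal (∫ u, ∑ b, rampBid k c d u b ∂unitUniform) :=
          (ofReal_integral_eq_lintegral_ofReal (integrable_finsetSum _ fun b _ =>
            integrable_rampBid b) (by
              filter_upwards [hbid] with u hu using Finset.sum_nonneg fun b _ => hu b)).symm
      _ ≤ ENNReal.ofReal R := ENNReal.ofReal_le_ofReal <| by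
          rw [integral_finsetSum _ fun b _ => integrable_rampBid b]
          simpa only [integral_rampBid (hk _)] using hcost

lemma integral_winShare_rampStrategy_right (t a : ℝ) (b : Fin n) :
    ∫ y, winShare t a (y b) ∂rampStrategy k c d =
      ∫ u, winShare t a (rampBid k c d u b) ∂unitUniform :=
  integral_map measurable_rampBid.aemeasurable
    (measurable_winShare t measurable_const (measurable_pi_apply b)).aestronglyMeasurable

lemma integral_winShare_rampStrategy_left (t q y : ℝ) (b : Fin n) :
    ∫ x, winShare t (x b + q) y ∂rampStrategy k c d =
      ∫ u, winShare t (rampBid k c d u b + q) y ∂unitUniform :=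
  integral_map measurable_rampBid.aemeasurable
    (measurable_winShare t (by fun_prop) measurable_const).aestronglyMeasurable

variable {τ w p : Fin n → ℝ} {RA RB : ℝ}

lemma le_integral_winShare_descending {t y : ℝ} {b : Fin n} (hτ : 0 ≤ τ b) (hw : 0 < w b)
    (ht : 0 < t) (hy : 0 ≤ y) :
    min (w b) (w b * k b + t⁻¹ * p b) - t⁻¹ * y ≤
      w b * ∫ u, winShare (τ b)
        (rampBid k (fun b => t * w b * k b) (fun b => -(t * w b)) u b + p b) y ∂unitUniform := by
  have htw := mul_pos ht hw
  set m := min 1 (k b + (p b - y) / (t * w b)) with hm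
  have hwin : ∀ u ∈ Set.Ioo 0 m,
      y < rampBid k (fun b => t * w b * k b) (fun b => -(t * w b)) u b + p b := by
    intro u hu
    have hu' : (u - k b) * (t * w b) < p b - y := by
      rw [← lt_div_iff₀ htw]
      linarith [hu.2.trans_le (min_le_right _ _)]
    unfold rampBid
    split_ifs with hub
    · linarith
    · linarith [mul_nonneg (sub_nonneg.2 (not_le.1 hub).le) htw.le]
  calc min (w b) (w b * k b + t⁻¹ * p b) - t⁻¹ * y
      ≤ min (w b) (w b * k b + t⁻¹ * (p b - y)) := by
        rw [mul_sub, ← add_sub_assoc, ← min_sub_sub_right]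
        exact min_le_min_right _ (sub_le_self _ (by positivity))
    _ = w b * (m - 0) := by
        rw [hm, sub_zero, mul_min_of_nonneg _ _ hw.le, mul_one]
        congr 1
        have := hw.ne'
        field_simp
    _ ≤ w b * unitUniform.real (Set.Ioo 0 m) :=
        mul_le_mul_of_nonneg_left (le_unitUniform_real_Ioo le_rfl (min_le_left _ _)) hw.le
    _ ≤ _ := mul_le_mul_of_nonneg_left (measureReal_le_integral_winShare hτ
        ((measurable_rampBid_apply b).add_const (p b)) measurable_const measurableSet_Ioo hwin)
        hw.le

lemma isSecuredByA_of_descending_bids {t : ℝ} (hτ : ∀ b, 0 ≤ τ b) (hw : ∀ b, 0 < w b) (hRB : 0 ≤ RB)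
    (ht : 0 < t) (hk : ∀ b, k b ∈ Set.Icc (0 : ℝ) 1)
    (hcost : t / 2 * ∑ b, w b * k b ^ 2 ≤ RA) :
    IsSecuredByA τ w p RA RB (∑ b, min (w b) (w b * k b + t⁻¹ * p b) - t⁻¹ * RB) := by
  refine ⟨rampStrategy k (fun b => t * w b * k b) (fun b => -(t * w b)),
    rampStrategy_mem_lottoStrategies hk (fun b u _ hu => ?_) ?_, fun FB hFB =>
    le_payoffA_of_le_integral_winShare hRB (inv_nonneg.2 ht.le) hFB fun b y hy => ?_⟩
  · linarith [mul_le_mul_of_nonneg_left hu (mul_pos ht (hw b)).le]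
  · refine le_trans (le_of_eq ?_) hcost
    rw [Finset.mul_sum]
    exact Finset.sum_congr rfl fun b _ => by ring
  · rw [integral_winShare_rampStrategy_left]
    exact le_integral_winShare_descending (hτ b) (hw b) ht hy

lemma integral_winShare_topping_le {s x : ℝ} {b : Fin n} (hτ : τ b ≤ 1) (hw : 0 < w b)
    (hs : 0 < s) (hk : k b ≤ 1) (hx : 0 ≤ x) :
    w b * ∫ u, winShare (τ b) (x + p b) (rampBid k p (fun b => s * w b) u b) ∂unitUniform ≤
      w b * (1 - k b) + s⁻¹ * x := by
  have hlose : ∀ u ∈ Set.Ioo (x / (s * w b)) (k b),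
      winShare (τ b) (x + p b) (rampBid k p (fun b => s * w b) u b) = 0 := by
    intro u hu
    apply winShare_of_gt
    rw [rampBid, if_pos hu.2.le]
    linarith [(div_lt_iff₀' (mul_pos hs hw)).1 hu.1]
  calc w b * ∫ u, winShare (τ b) (x + p b) (rampBid k p (fun b => s * w b) u b) ∂unitUniform
      ≤ w b * (1 - unitUniform.real (Set.Ioo (x / (s * w b)) (k b))) :=
        mul_le_mul_of_nonneg_left (integral_winShare_le_one_sub_measureReal hτ measurable_const
          (measurable_rampBid_apply b) measurableSet_Ioo hlose) hw.le
    _ ≤ w b * (1 - (k b - x / (s * w b))) :=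
        mul_le_mul_of_nonneg_left
          (sub_le_sub_left (le_unitUniform_real_Ioo (by positivity) hk) 1) hw.le
    _ = w b * (1 - k b) + s⁻¹ * x := by
        have := hw.ne'
        field_simp
        ring

lemma isCappedByB_of_topping_bids {s : ℝ} (hτ : ∀ b, τ b ≤ 1) (hw : ∀ b, 0 < w b)
    (hp : ∀ b, 0 ≤ p b) (hRA : 0 ≤ RA) (hs : 0 < s) (hk : ∀ b, k b ∈ Set.Icc (0 : ℝ) 1)
    (hcost : ∑ b, p b * k b + s / 2 * ∑ b, w b * k b ^ 2 ≤ RB) :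
    IsCappedByB τ w p RA RB (∑ b, w b * (1 - k b) + s⁻¹ * RA) := by
  refine ⟨rampStrategy k p (fun b => s * w b),
    rampStrategy_mem_lottoStrategies hk (fun b u hu _ => ?_) ?_, fun FA hFA =>
    payoffA_le_of_integral_winShare_le hRA (inv_nonneg.2 hs.le) hFA fun b x hx => ?_⟩
  · exact add_nonneg (hp b) (mul_nonneg (mul_pos hs (hw b)).le hu)
  · refine le_trans (le_of_eq ?_) hcost
    rw [Finset.mul_sum, ← Finset.sum_add_distrib]
    exact Finset.sum_congr rfl fun b _ => by ring
  · rw [integral_winShare_rampStrategy_right]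
    exact integral_winShare_topping_le (hτ b) (hw b) hs (hk b).2 hx

lemma isCappedByB_of_matching_bids (hw : ∀ b, 0 ≤ w b)
    (hp : ∀ b, 0 ≤ p b) (hk : ∀ b, k b ∈ Set.Icc (0 : ℝ) 1)
    (hcost : ∑ b, p b * k b ≤ RB) :
    IsCappedByB (fun _ => 0) w p 0 RB (∑ b, w b * (1 - k b)) := by
  refine ⟨rampStrategy k p 0, rampStrategy_mem_lottoStrategies hk (fun b u _ _ => ?_) (by simpa),
    fun FA hFA => ?_⟩
  · simpa using hp b
  · rw [payoffA_eq_of_mem_lottoStrategies_zero hFA]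
    gcongr with b
    · exact hw b
    rw [integral_winShare_rampStrategy_right]
    have hlose : ∀ u ∈ Set.Ioo 0 (k b), winShare 0 (p b) (rampBid k p 0 u b) = 0 := by
      intro u hu
      simp [rampBid, hu.2.le, winShare]
    calc ∫ u, winShare 0 (p b) (rampBid k p 0 u b) ∂unitUniform
        ≤ 1 - unitUniform.real (Set.Ioo 0 (k b)) :=
          integral_winShare_le_one_sub_measureReal zero_le_one measurable_const
            (measurable_rampBid_apply b) measurableSet_Ioo hlose
      _ ≤ 1 - k b := by
          linarith [le_unitUniform_real_Ioo le_rfl (hk b).2]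

end UniformBids

section Lagrangian

/-- The Lagrangian of the subgame after `p`, at a reduced profile of the two players: `B` contests
battlefield `b` with probability `η b`, and `y = (ξ, l)` collects the probability `ξ b` with which
`A` adds to the pre-allocation on `b` and the multiplier `l` of `B`'s budget constraint. It is
affine in `η` and in `y`. -/
def lagrangian {n : ℕ} (w p : Fin n → ℝ) (RB : ℝ) (η : Fin n → ℝ) (y : (Fin n → ℝ) × ℝ) : ℝ :=
  ∑ b, (w b * (1 - η b) + η b * (w b * y.1 b + y.2 * p b)) - y.2 * RB

/-- The pairs `(ξ, l)` for which the bids of slope `l⁻¹ * w b` and depth `ξ b` respect `A`'s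
budget. Clearing the denominator `l` turns the budget constraint into that of a convex cone. -/
def budgetCone {n : ℕ} (w : Fin n → ℝ) (RA : ℝ) : Set ((Fin n → ℝ) × ℝ) :=
  {y | 0 ≤ y.2 ∧ ∑ b, w b * y.1 b ^ 2 ≤ 2 * RA * y.2}

variable {n : ℕ} {τ w p η : Fin n → ℝ} {RA RB : ℝ}

lemma lagrangian_combo_left {a a' : ℝ} (haa : a + a' = 1) (η η' : Fin n → ℝ)
    (y : (Fin n → ℝ) × ℝ) :
    lagrangian w p RB (a • η + a' • η') y =
      a * lagrangian w p RB η y + a' * lagrangian w p RB η' y := by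
  obtain rfl : a' = 1 - a := by linarith
  simp only [lagrangian, Pi.add_apply, Pi.smul_apply, smul_eq_mul, mul_sub, Finset.mul_sum]
  rw [sub_add_sub_comm, ← Finset.sum_add_distrib]
  congr 1
  · exact Finset.sum_congr rfl fun b _ => by ring
  · ring

lemma lagrangian_combo_right {a a' : ℝ} (haa : a + a' = 1) (η : Fin n → ℝ)
    (y y' : (Fin n → ℝ) × ℝ) :
    lagrangian w p RB η (a • y + a' • y') =
      a * lagrangian w p RB η y + a' * lagrangian w p RB η y' := by
  obtain rfl : a' = 1 - a := by linarith
  simp only [lagrangian, Prod.fst_add, Prod.snd_add, Prod.smul_fst, Prod.smul_snd, Pi.add_apply,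
    Pi.smul_apply, smul_eq_mul, mul_sub, Finset.mul_sum]
  rw [sub_add_sub_comm, ← Finset.sum_add_distrib]
  congr 1
  · exact Finset.sum_congr rfl fun b _ => by ring
  · ring

lemma continuous_lagrangian_left (y : (Fin n → ℝ) × ℝ) :
    Continuous fun η => lagrangian w p RB η y := by
  unfold lagrangian
  fun_prop

lemma continuous_lagrangian_right : Continuous (lagrangian w p RB η) := by
  unfold lagrangian
  fun_prop

lemma lagrangian_zero_left (y : (Fin n → ℝ) × ℝ) :
    lagrangian w p RB 0 y = ∑ b, w b - y.2 * RB := by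
  simp [lagrangian]

lemma lagrangian_zero_right : lagrangian w p RB η 0 = ∑ b, w b * (1 - η b) := by
  simp [lagrangian]

lemma lagrangian_smul_right (α l : ℝ) :
    lagrangian w p RB η (α • η, l) =
      ∑ b, w b * (1 - η b) + α * ∑ b, w b * η b ^ 2 + l * (∑ b, p b * η b - RB) := by
  rw [lagrangian, mul_sub, ← add_sub_assoc, Finset.mul_sum, Finset.mul_sum,
    ← Finset.sum_add_distrib, ← Finset.sum_add_distrib]
  congr 1
  exact Finset.sum_congr rfl fun b _ => by
    simp only [Pi.smul_apply, smul_eq_mul]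
    ring

lemma zero_mem_budgetCone : (0 : (Fin n → ℝ) × ℝ) ∈ budgetCone w RA := by
  simp [budgetCone]

lemma convex_budgetCone (hw : ∀ b, 0 ≤ w b) : Convex ℝ (budgetCone w RA) := by
  rintro ⟨ξ, l⟩ ⟨hl, hξ⟩ ⟨ξ', l'⟩ ⟨hl', hξ'⟩ a a' ha ha' haa
  refine ⟨add_nonneg (mul_nonneg ha hl) (mul_nonneg ha' hl'), ?_⟩
  calc ∑ b, w b * (a * ξ b + a' * ξ' b) ^ 2
      ≤ ∑ b, w b * (a * ξ b ^ 2 + a' * ξ' b ^ 2) := by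
        gcongr with b
        · exact hw b
        · exact (even_two.convexOn_pow (𝕜 := ℝ)).2 trivial trivial ha ha' haa
    _ = a * ∑ b, w b * ξ b ^ 2 + a' * ∑ b, w b * ξ' b ^ 2 := by
        rw [Finset.mul_sum, Finset.mul_sum, ← Finset.sum_add_distrib]
        exact Finset.sum_congr rfl fun b _ => by ring
    _ ≤ a * (2 * RA * l) + a' * (2 * RA * l') := by gcongr
    _ = 2 * RA * (a * l + a' * l') := by ring

lemma isClosed_budgetCone : IsClosed (budgetCone w RA) :=
  (isClosed_le continuous_const continuous_snd).inter
    (isClosed_le (f := fun y : (Fin n → ℝ) × ℝ => ∑ b, w b * y.1 b ^ 2) (by fun_prop)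
      (continuous_const.mul continuous_snd))

lemma isCompact_budgetCone_inter (hw : ∀ b, 0 < w b) (hRA : 0 ≤ RA) (Λ : ℝ) :
    IsCompact (budgetCone w RA ∩ {y | y.2 ≤ Λ}) := by
  let K : Fin n → ℝ := fun b => √(2 * RA * Λ / w b)
  refine (isCompact_Icc (a := (-K, 0)) (b := (K, Λ))).of_isClosed_subset
    (isClosed_budgetCone.inter (isClosed_le continuous_snd continuous_const)) ?_
  rintro ⟨ξ, l⟩ ⟨⟨hl, hξ⟩, hlΛ⟩
  have habs : ∀ b, |ξ b| ≤ K b := fun b => Real.abs_le_sqrt <| by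
    rw [le_div_iff₀' (hw b)]
    calc w b * ξ b ^ 2 ≤ ∑ b, w b * ξ b ^ 2 :=
          Finset.single_le_sum (f := fun b => w b * ξ b ^ 2)
            (fun b _ => mul_nonneg (hw b).le (sq_nonneg _)) (Finset.mem_univ b)
      _ ≤ 2 * RA * l := hξ
      _ ≤ 2 * RA * Λ := by gcongr; exact hlΛ
  exact ⟨⟨fun b => (abs_le.1 (habs b)).1, hl⟩, ⟨fun b => (abs_le.1 (habs b)).2, hlΛ⟩⟩

lemma exists_lagrangian_isSaddlePointOn_truncated (hw : ∀ b, 0 < w b) (hRA : 0 ≤ RA) {Λ : ℝ}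
    (hΛ : 0 ≤ Λ) :
    ∃ η ∈ Set.Icc (0 : Fin n → ℝ) 1, ∃ y ∈ budgetCone w RA ∩ {y | y.2 ≤ Λ},
      IsSaddlePointOn (Set.Icc 0 1) (budgetCone w RA ∩ {y | y.2 ≤ Λ}) (lagrangian w p RB) η y := by
  have hconv : Convex ℝ (budgetCone w RA ∩ {y | y.2 ≤ Λ}) :=
    (convex_budgetCone fun b => (hw b).le).inter
      (convex_halfSpace_le (LinearMap.snd ℝ (Fin n → ℝ) ℝ).isLinear Λ)
  refine Sion.exists_isSaddlePointOn ⟨0, by simp⟩ (convex_Icc 0 1) isCompact_Icc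
    (fun y _ => (continuous_lagrangian_left y).continuousOn.lowerSemicontinuousOn)
    (fun y _ => ConvexOn.quasiconvexOn ⟨convex_Icc 0 1, fun η _ η' _ a a' _ _ haa =>
      (lagrangian_combo_left haa η η' y).le⟩)
    hconv ⟨0, zero_mem_budgetCone, hΛ⟩ (isCompact_budgetCone_inter hw hRA Λ)
    (fun η _ => continuous_lagrangian_right.continuousOn.upperSemicontinuousOn)
    (fun η _ => ConcaveOn.quasiconcaveOn ⟨hconv, fun y _ y' _ a a' _ _ haa =>
      (lagrangian_combo_right haa η y y').ge⟩)

lemma exists_lagrangian_isSaddlePointOn (hw : ∀ b, 0 < w b) (hRA : 0 ≤ RA) (hRB : 0 < RB) :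
    ∃ η ∈ Set.Icc (0 : Fin n → ℝ) 1, ∃ y ∈ budgetCone w RA,
      IsSaddlePointOn (Set.Icc 0 1) (budgetCone w RA) (lagrangian w p RB) η y := by
  have hw_sum : 0 ≤ ∑ b, w b := Finset.sum_nonneg fun b _ => (hw b).le
  set Λ : ℝ := (∑ b, w b + 1) / RB
  have hΛ : 0 ≤ Λ := by positivity
  obtain ⟨η, hη, y, ⟨hy, -⟩, hsaddle⟩ := exists_lagrangian_isSaddlePointOn_truncated
    (p := p) (RB := RB) hw hRA hΛ
  have hy_lt : y.2 < Λ := by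
    have hzero : lagrangian w p RB η 0 ≤ lagrangian w p RB 0 y :=
      hsaddle 0 (by simp) 0 ⟨zero_mem_budgetCone, hΛ⟩
    rw [lagrangian_zero_right, lagrangian_zero_left] at hzero
    have : 0 ≤ ∑ b, w b * (1 - η b) := Finset.sum_nonneg fun b _ =>
      mul_nonneg (hw b).le (sub_nonneg.2 (hη.2 b))
    rw [lt_div_iff₀ hRB]
    linarith
  have hlocal : IsLocalMaxOn (lagrangian w p RB η) (budgetCone w RA) y := by
    filter_upwards [self_mem_nhdsWithin, mem_nhdsWithin_of_mem_nhds
      ((isOpen_lt continuous_snd continuous_const).mem_nhds hy_lt)] with y' hy' hy'_lt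
    exact hsaddle η hη y' ⟨hy', le_of_lt hy'_lt⟩
  have hmax := IsMaxOn.of_isLocalMaxOn_of_concaveOn hy hlocal
    ⟨convex_budgetCone fun b => (hw b).le, fun y _ y' _ a a' _ _ haa =>
      (lagrangian_combo_right haa η y y').ge⟩
  exact ⟨η, hη, y, hy, fun η' hη' y' hy' =>
    (hmax hy').trans (hsaddle η' hη' y ⟨hy, hy_lt.le⟩)⟩

/-- Which side of the minimum is attained tells whether `B` should contest the battlefield. -/
lemma exists_lagrangian_eq_sum_min (y : (Fin n → ℝ) × ℝ) :
    ∃ η ∈ Set.Icc (0 : Fin n → ℝ) 1, lagrangian w p RB η y =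
      ∑ b, min (w b) (w b * y.1 b + y.2 * p b) - y.2 * RB := by
  refine ⟨fun b => if w b ≤ w b * y.1 b + y.2 * p b then 0 else 1,
    ⟨fun b => by dsimp; split_ifs <;> simp, fun b => by dsimp; split_ifs <;> simp⟩, ?_⟩
  rw [lagrangian]
  congr 1
  refine Finset.sum_congr rfl fun b _ => ?_
  split_ifs with h
  · simp [h]
  · simp [(not_le.1 h).le]

lemma isSecuredByA_of_le_lagrangian {V : ℝ} (hτ : ∀ b, 0 ≤ τ b) (hw : ∀ b, 0 < w b)
    (hp : ∀ b, 0 ≤ p b) (hRB : 0 ≤ RB) {y : (Fin n → ℝ) × ℝ} (hy : y ∈ budgetCone w RA)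
    (hy_pos : 0 < y.2)
    (hV : ∀ η ∈ Set.Icc (0 : Fin n → ℝ) 1, V ≤ lagrangian w p RB η y) :
    IsSecuredByA τ w p RA RB V := by
  obtain ⟨ξ, l⟩ := y
  obtain ⟨η, hη, hη_eq⟩ := exists_lagrangian_eq_sum_min (w := w) (p := p) (RB := RB) (ξ, l)
  let k : Fin n → ℝ := fun b => max 0 (min 1 (ξ b))
  have hk : ∀ b, k b ∈ Set.Icc (0 : ℝ) 1 := fun b =>
    ⟨le_max_left _ _, max_le zero_le_one (min_le_left _ _)⟩
  have hk_sq : ∀ b, k b ^ 2 ≤ ξ b ^ 2 := fun b => sq_le_sq.2 <| by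
    rw [abs_of_nonneg (hk b).1]
    exact max_le (abs_nonneg _) ((min_le_right _ _).trans (le_abs_self _))
  have hk_min : ∀ b, min (w b) (w b * ξ b + l * p b) ≤ min (w b) (w b * k b + l * p b) := by
    intro b
    have hlp : 0 ≤ l * p b := mul_nonneg hy_pos.le (hp b)
    rcases le_total (ξ b) 1 with hξ | hξ
    · gcongr
      · exact (hw b).le
      · exact (le_min hξ le_rfl).trans (le_max_right _ _)
    · have : k b = 1 := by simp [k, hξ]
      rw [this, mul_one, min_eq_left (by linarith : w b ≤ w b + l * p b)]
      exact min_le_left _ _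
  have hcost : l⁻¹ / 2 * ∑ b, w b * k b ^ 2 ≤ RA := by
    calc l⁻¹ / 2 * ∑ b, w b * k b ^ 2 ≤ l⁻¹ / 2 * ∑ b, w b * ξ b ^ 2 := by
          gcongr l⁻¹ / 2 * ∑ b, ?_ with b
          exact mul_le_mul_of_nonneg_left (hk_sq b) (hw b).le
      _ ≤ l⁻¹ / 2 * (2 * RA * l) := by gcongr; exact hy.2
      _ = RA := by
          have : l ≠ 0 := hy_pos.ne'
          field_simp
  refine (isSecuredByA_of_descending_bids hτ hw hRB (inv_pos.2 hy_pos) hk hcost).mono ?_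
  calc V ≤ ∑ b, min (w b) (w b * ξ b + l * p b) - l * RB := hη_eq ▸ hV η hη
    _ ≤ ∑ b, min (w b) (w b * k b + l * p b) - l * RB :=
      sub_le_sub_right (Finset.sum_le_sum fun b _ => hk_min b) _
    _ = ∑ b, min (w b) (w b * k b + l⁻¹⁻¹ * p b) - l⁻¹⁻¹ * RB := by rw [inv_inv]

/-- A vanishing multiplier forces `ξ = 0`, and then contesting every battlefield leaves `A`
nothing. -/
lemma nonpos_of_le_lagrangian_of_snd_eq_zero {V : ℝ} (hw : ∀ b, 0 < w b)
    {y : (Fin n → ℝ) × ℝ} (hy : y ∈ budgetCone w RA) (hy_zero : y.2 = 0)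
    (hV : ∀ η ∈ Set.Icc (0 : Fin n → ℝ) 1, V ≤ lagrangian w p RB η y) : V ≤ 0 := by
  obtain ⟨ξ, l⟩ := y
  obtain rfl : l = 0 := hy_zero
  have hnonneg : ∀ b, 0 ≤ w b * ξ b ^ 2 := fun b => mul_nonneg (hw b).le (sq_nonneg _)
  have hsum : ∑ b, w b * ξ b ^ 2 = 0 :=
    (hy.2.trans (by simp)).antisymm (Finset.sum_nonneg fun b _ => hnonneg b)
  have hξ : ∀ b, ξ b = 0 := fun b => by
    simpa [(hw b).ne'] using
      (Finset.sum_eq_zero_iff_of_nonneg fun b _ => hnonneg b).1 hsum b (Finset.mem_univ b)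
  simpa [lagrangian, hξ] using hV 1 (by simp)

section Topping

variable {V : ℝ} (hV : ∀ y ∈ budgetCone w RA, lagrangian w p RB η y ≤ V)
include hV

lemma sum_add_mul_le_of_lagrangian_le {α l : ℝ} (hl : 0 ≤ l)
    (hα : α ^ 2 * ∑ b, w b * η b ^ 2 ≤ 2 * RA * l) :
    ∑ b, w b * (1 - η b) + α * ∑ b, w b * η b ^ 2 + l * (∑ b, p b * η b - RB) ≤ V := by
  rw [← lagrangian_smul_right]
  refine hV _ ⟨hl, le_trans (le_of_eq ?_) hα⟩
  simp only [Pi.smul_apply, smul_eq_mul, Finset.mul_sum]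
  exact Finset.sum_congr rfl fun b _ => by ring

lemma sum_le_of_lagrangian_le : ∑ b, w b * (1 - η b) ≤ V := by
  simpa using sum_add_mul_le_of_lagrangian_le hV (α := 0) (l := 0) le_rfl (by simp)

lemma sum_mul_le_of_lagrangian_le (hRA : 0 ≤ RA) : ∑ b, p b * η b ≤ RB := by
  by_contra! hlt
  set E := ∑ b, w b * (1 - η b)
  have hgap := sub_pos.2 hlt
  have hE : E ≤ V := sum_le_of_lagrangian_le hV
  have hl : 0 ≤ (V - E + 1) / (∑ b, p b * η b - RB) := by
    apply div_nonneg <;> linarith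
  have := sum_add_mul_le_of_lagrangian_le hV (α := 0) hl
    (by simpa using mul_nonneg (mul_nonneg zero_le_two hRA) hl)
  rw [div_mul_cancel₀ _ hgap.ne'] at this
  linarith

lemma sum_sq_pos_of_lagrangian_le (hw : ∀ b, 0 < w b) (hlt : V < ∑ b, w b) :
    0 < ∑ b, w b * η b ^ 2 := by
  obtain ⟨b, hb⟩ : ∃ b, η b ≠ 0 := by
    by_contra! hη
    have := sum_le_of_lagrangian_le hV
    simp only [hη, sub_zero, mul_one] at this
    linarith
  exact Finset.sum_pos' (fun b _ => mul_nonneg (hw b).le (sq_nonneg _))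
    ⟨b, Finset.mem_univ b, mul_pos (hw b) (by positivity)⟩

/-- If `B`'s budget were exhausted, `A`'s bids could be made arbitrarily deep. -/
lemma sum_mul_lt_of_lagrangian_le (hRA : 0 < RA) (hS : 0 < ∑ b, w b * η b ^ 2) :
    ∑ b, p b * η b < RB := by
  by_contra! hge
  set E := ∑ b, w b * (1 - η b)
  set S := ∑ b, w b * η b ^ 2
  have hl : 0 ≤ ((V - E + 1) / S) ^ 2 * S / (2 * RA) := by positivity
  have := sum_add_mul_le_of_lagrangian_le hV (α := (V - E + 1) / S) hl
    (mul_div_cancel₀ _ (by positivity)).ge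
  rw [div_mul_cancel₀ _ hS.ne'] at this
  linarith [mul_nonneg hl (sub_nonneg.2 hge)]

lemma isCappedByB_of_lagrangian_le_of_lt (hτ : ∀ b, τ b ≤ 1) (hw : ∀ b, 0 < w b)
    (hp : ∀ b, 0 ≤ p b) (hRA : 0 ≤ RA) (hη : η ∈ Set.Icc (0 : Fin n → ℝ) 1)
    (hS : 0 < ∑ b, w b * η b ^ 2) (hQ : ∑ b, p b * η b < RB) :
    IsCappedByB τ w p RA RB V := by
  set S := ∑ b, w b * η b ^ 2 with hS_def
  set Q := ∑ b, p b * η b with hQ_def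
  have hQ' : 0 < RB - Q := sub_pos.2 hQ
  have hs : 0 < 2 * (RB - Q) / S := by positivity
  refine (isCappedByB_of_topping_bids (s := 2 * (RB - Q) / S) hτ hw hp hRA hs
    (fun b => ⟨hη.1 b, hη.2 b⟩) ?_).mono ?_
  · rw [← hS_def, ← hQ_def]
    exact le_of_eq (by field_simp; ring)
  · refine le_trans (le_of_eq ?_) (sum_add_mul_le_of_lagrangian_le hV (α := RA / (RB - Q))
      (l := RA * S / (2 * (RB - Q) ^ 2)) (by positivity) (le_of_eq ?_))
    · rw [← hS_def, ← hQ_def]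
      field_simp
      ring
    · rw [← hS_def]
      field_simp

lemma isCappedByB_of_lagrangian_le (hτ : ∀ b, τ b ≤ 1) (hw : ∀ b, 0 < w b) (hp : ∀ b, 0 ≤ p b)
    (hRA : 0 ≤ RA) (hη : η ∈ Set.Icc (0 : Fin n → ℝ) 1) (hlt : V < ∑ b, w b)
    (h : 0 < RA ∨ ∑ b, p b < RB ∨ τ = fun _ => 0) : IsCappedByB τ w p RA RB V := by
  have hS := sum_sq_pos_of_lagrangian_le hV hw hlt
  have hηp : ∑ b, p b * η b ≤ ∑ b, p b :=
    Finset.sum_le_sum fun b _ => mul_le_of_le_one_right (hp b) (hη.2 b)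
  have hcontest := fun hQ => isCappedByB_of_lagrangian_le_of_lt hV hτ hw hp hRA hη hS hQ
  rcases hRA.eq_or_lt with rfl | hRA
  · rcases h with h | h | rfl
    · exact absurd h (lt_irrefl 0)
    · exact hcontest (hηp.trans_lt h)
    · exact (isCappedByB_of_matching_bids (fun b => (hw b).le) hp (fun b => ⟨hη.1 b, hη.2 b⟩)
        (sum_mul_le_of_lagrangian_le hV le_rfl)).mono (sum_le_of_lagrangian_le hV)
  · exact hcontest (sum_mul_lt_of_lagrangian_le hV hRA hS)

end Topping

theorem exists_isSubgameNash_of_nonneg (hτ : ∀ b, τ b ∈ Set.Icc (0 : ℝ) 1) (hw : ∀ b, 0 < w b)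
    (hw_sum : 0 < ∑ b, w b) (hp : ∀ b, 0 ≤ p b) (hRA : 0 ≤ RA) (hRB : 0 < RB)
    (h : 0 < RA ∨ ∑ b, p b < RB ∨ τ = fun _ => 0) : ∃ FA FB, IsSubgameNash τ w p RA RB FA FB := by
  obtain ⟨η, hη, y, hy, hsaddle⟩ :=
    exists_lagrangian_isSaddlePointOn (p := p) hw hRA hRB
  set V := lagrangian w p RB η y
  have hA : ∀ η' ∈ Set.Icc (0 : Fin n → ℝ) 1, V ≤ lagrangian w p RB η' y := fun η' hη' =>
    hsaddle η' hη' y hy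
  have hB : ∀ y' ∈ budgetCone w RA, lagrangian w p RB η y' ≤ V := fun y' hy' =>
    hsaddle η hη y' hy'
  have hτ0 := fun b => (hτ b).1
  rcases hy.1.eq_or_lt with hzero | hpos
  · have hV := nonpos_of_le_lagrangian_of_snd_eq_zero hw hy hzero.symm hA
    exact exists_isSubgameNash ((isSecuredByA_zero (fun b => (hw b).le) hτ0).mono hV)
      (isCappedByB_of_lagrangian_le hB (fun b => (hτ b).2) hw hp hRA hη (hV.trans_lt hw_sum) h)
  · have hV : V ≤ ∑ b, w b - y.2 * RB := lagrangian_zero_left (p := p) y ▸ hA 0 (by simp)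
    exact exists_isSubgameNash (isSecuredByA_of_le_lagrangian hτ0 hw hp hRB.le hy hpos hA)
      (isCappedByB_of_lagrangian_le hB (fun b => (hτ b).2) hw hp hRA hη
        (by linarith [mul_pos hpos hRB]) h)

end Lagrangian

section BidCeiling

/-- The root `t ≥ P` of `(t - P) ^ 2 = 2 * t * RA`. If `A` pre-allocates proportionally to the
values and `B` cannot afford to contest every battlefield, it is the largest total of
pre-allocation and bid that `A` places per unit of value. -/
noncomputable def bidCeiling (P RA : ℝ) : ℝ :=
  P + RA + √(RA ^ 2 + 2 * P * RA)

/-- The closed form of `A`'s equilibrium payoff. The first case is the one in which `B` can afford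
to contest every battlefield; it entails `P < RB`. -/
noncomputable def lottoValue (P RA RB : ℝ) : ℝ :=
  if bidCeiling P RA + P < 2 * RB then RA / (2 * (RB - P)) else 1 - RB / bidCeiling P RA

variable {P RA RB T : ℝ}

lemma add_le_bidCeiling (P RA : ℝ) : P + RA ≤ bidCeiling P RA :=
  le_add_of_nonneg_right (Real.sqrt_nonneg _)

lemma bidCeiling_zero_right (P : ℝ) : bidCeiling P 0 = P := by
  simp [bidCeiling]

lemma exists_pos_mul_eq_sub_bidCeiling (hP : 0 ≤ P) (hRA : 0 ≤ RA) (hT : P < T) :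
    ∃ m > 0, (T - P) ^ 2 - 2 * T * RA = m * (T - bidCeiling P RA) := by
  have hsq : √(RA ^ 2 + 2 * P * RA) ^ 2 = RA ^ 2 + 2 * P * RA := Real.sq_sqrt (by positivity)
  have hle : RA ≤ √(RA ^ 2 + 2 * P * RA) :=
    Real.le_sqrt_of_sq_le (le_add_of_nonneg_right (by positivity))
  refine ⟨T - P - RA + √(RA ^ 2 + 2 * P * RA), by linarith, ?_⟩
  rw [bidCeiling]
  linear_combination hsq

lemma bidCeiling_lt_iff (hP : 0 ≤ P) (hRA : 0 ≤ RA) (hT : P < T) :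
    bidCeiling P RA < T ↔ 2 * T * RA < (T - P) ^ 2 := by
  obtain ⟨m, hm, heq⟩ := exists_pos_mul_eq_sub_bidCeiling hP hRA hT
  rw [← sub_pos, ← sub_pos (b := 2 * T * RA), heq, mul_pos_iff_of_pos_left hm]

lemma bidCeiling_eq_iff (hP : 0 ≤ P) (hRA : 0 ≤ RA) (hT : 0 < T) (hPT : P ≤ T) :
    bidCeiling P RA = T ↔ 2 * T * RA = (T - P) ^ 2 := by
  rcases hPT.eq_or_lt with rfl | hPT
  · have : bidCeiling P RA = P ↔ RA = 0 :=
      ⟨fun h => by linarith [add_le_bidCeiling P RA], fun h => h ▸ bidCeiling_zero_right P⟩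
    simp [this, hT.ne']
  · obtain ⟨m, hm, heq⟩ := exists_pos_mul_eq_sub_bidCeiling hP hRA hPT
    rw [← sub_eq_zero, eq_comm (a := 2 * T * RA), ← sub_eq_zero (a := (T - P) ^ 2), heq,
      mul_eq_zero, or_iff_right hm.ne', ← neg_sub T, neg_eq_zero]

lemma bidCeiling_sq (hP : 0 ≤ P) (hRA : 0 ≤ RA) (hpos : 0 < bidCeiling P RA) :
    (bidCeiling P RA - P) ^ 2 = 2 * bidCeiling P RA * RA :=
  ((bidCeiling_eq_iff hP hRA hpos (by linarith [add_le_bidCeiling P RA])).1 rfl).symm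

lemma le_lottoValue (hP : 0 ≤ P) (hRA : 0 ≤ RA) (hRB : 0 < RB) {v : ℝ}
    (hv : ∀ k : ℝ, 0 < k → k ≤ 1 → k * P < RB → v ≤ 1 - k + RA * k ^ 2 / (2 * (RB - k * P))) :
    v ≤ lottoValue P RA RB := by
  have hle := add_le_bidCeiling P RA
  unfold lottoValue
  split_ifs with hcase
  · simpa using hv 1 one_pos le_rfl (by linarith)
  rcases hRA.eq_or_lt with rfl | hRA
  · rw [bidCeiling_zero_right] at hcase ⊢
    have hP : 0 < P := by linarith
    -- `B` contests with a probability just short of the unaffordable `RB / P`.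
    by_contra! hlt
    obtain ⟨k, hvk, hk⟩ := exists_between
      (max_lt (by linarith : 1 - v < RB / P) (div_pos hRB hP))
    have hkP : k * P < RB := (lt_div_iff₀ hP).1 hk
    have := hv k ((le_max_right _ _).trans_lt hvk) (hk.le.trans ((div_le_one hP).2 (by linarith)))
      hkP
    rw [zero_mul, zero_div] at this
    linarith [(le_max_left (1 - v) 0).trans_lt hvk]
  · set t := bidCeiling P RA
    have ht : 0 < t := by linarith
    have hsq : (t - P) ^ 2 = 2 * t * RA := bidCeiling_sq hP hRA.le ht
    have htP : 0 < t - P := by linarith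
    have hkP : RB - 2 * RB / (t + P) * P = RB * (t - P) / (t + P) := by
      field_simp
      ring
    -- The bound is minimal at `k = 2 * RB / (t + P)`.
    have hk := hv (2 * RB / (t + P)) (by positivity) ((div_le_one (by positivity)).2 (by linarith))
      (sub_pos.1 (hkP ▸ by positivity))
    have hRA_eq : RA = (t - P) ^ 2 / (2 * t) := by
      field_simp
      linarith
    refine hk.trans (le_of_eq ?_)
    rw [hkP, hRA_eq]
    field_simp
    ring

end BidCeiling

section Equilibrium

variable {n : ℕ} {τ w p : Fin n → ℝ} {P RA RB v : ℝ}

lemma isCappedByB_of_uniform_contest (hτ : ∀ b, τ b ≤ 1) (hw : ∀ b, 0 < w b) (hsum : ∑ b, w b = 1)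
    (hp : p ∈ preallocations n P) (hRA : 0 ≤ RA) {k : ℝ} (hk0 : 0 < k) (hk1 : k ≤ 1)
    (hkP : k * P < RB) :
    IsCappedByB τ w p RA RB (1 - k + RA * k ^ 2 / (2 * (RB - k * P))) := by
  have hgap := sub_pos.2 hkP
  have hcap := isCappedByB_of_topping_bids (s := 2 * (RB - k * P) / k ^ 2) (k := fun _ => k)
    (RB := RB) hτ hw hp.1 hRA (by positivity) (fun _ => ⟨hk0.le, hk1⟩) (by
      rw [← Finset.sum_mul, ← Finset.sum_mul, hp.2, hsum]
      exact le_of_eq (by field_simp; ring))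
  refine hcap.mono (le_of_eq ?_)
  rw [← Finset.sum_mul, hsum]
  field_simp

lemma IsSubgameNash.payoffA_le_lottoValue {FA FB : Measure (Fin n → ℝ)} (hτ : ∀ b, τ b ≤ 1)
    (hw : ∀ b, 0 < w b) (hsum : ∑ b, w b = 1) (hP : 0 ≤ P) (hRA : 0 ≤ RA) (hRB : 0 < RB)
    (hp : p ∈ preallocations n P) (h : IsSubgameNash τ w p RA RB FA FB) :
    payoffA τ w p FA FB ≤ lottoValue P RA RB :=
  le_lottoValue hP hRA hRB fun _ hk0 hk1 hkP =>
    h.payoffA_le (isCappedByB_of_uniform_contest hτ hw hsum hp hRA hk0 hk1 hkP)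

lemma isSecuredByA_of_proportional {t k : ℝ} (hτ : ∀ b, 0 ≤ τ b) (hw : ∀ b, 0 < w b)
    (hsum : ∑ b, w b = 1) (hRB : 0 ≤ RB) (ht : 0 < t) (hk0 : 0 ≤ k) (hk1 : k ≤ 1)
    (hkP : k + t⁻¹ * P ≤ 1) (hcost : t / 2 * k ^ 2 ≤ RA) :
    IsSecuredByA τ w (fun b => w b * P) RA RB (k + t⁻¹ * P - t⁻¹ * RB) := by
  have hsec := isSecuredByA_of_descending_bids (p := fun b => w b * P) (RB := RB) (RA := RA)
    (k := fun _ => k) hτ hw hRB ht (fun _ => ⟨hk0, hk1⟩) (by rwa [← Finset.sum_mul, hsum, one_mul])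
  refine hsec.mono (sub_le_sub_right (le_of_eq ?_) _)
  calc k + t⁻¹ * P = ∑ b, w b * (k + t⁻¹ * P) := by rw [← Finset.sum_mul, hsum, one_mul]
    _ = ∑ b, min (w b) (w b * k + t⁻¹ * (w b * P)) := Finset.sum_congr rfl fun b _ => by
      rw [mul_left_comm, ← mul_add, min_eq_right (mul_le_of_le_one_right (hw b).le hkP)]

lemma isSecuredByA_lottoValue (hτ : ∀ b, 0 ≤ τ b) (hw : ∀ b, 0 < w b) (hsum : ∑ b, w b = 1)
    (hP : 0 ≤ P) (hRA : 0 ≤ RA) (hRB : 0 < RB) :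
    IsSecuredByA τ w (fun b => w b * P) RA RB (lottoValue P RA RB) := by
  have hle := add_le_bidCeiling P RA
  unfold lottoValue
  split_ifs with hcase
  · have hgap : 0 < RB - P := by linarith
    rcases hRA.eq_or_lt with rfl | hRA
    · simpa using isSecuredByA_zero (fun b => (hw b).le) hτ
    have hbound : 2 * (2 * RB - P) * RA < (2 * RB - P - P) ^ 2 :=
      (bidCeiling_lt_iff hP hRA.le (by linarith)).1 (by linarith)
    have hratio : RA / (RB - P) + (2 * (RB - P) ^ 2 / RA)⁻¹ * P ≤ 1 := by
      have : RA / (RB - P) + (2 * (RB - P) ^ 2 / RA)⁻¹ * P =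
          2 * (2 * RB - P) * RA / (2 * RB - P - P) ^ 2 := by
        have : 2 * RB - P - P = 2 * (RB - P) := by ring
        rw [this]
        field_simp
        ring
      rw [this]
      exact div_le_one_of_le₀ hbound.le (sq_nonneg _)
    have hsec := isSecuredByA_of_proportional (P := P) (RA := RA) (t := 2 * (RB - P) ^ 2 / RA)
      (k := RA / (RB - P)) hτ hw hsum hRB.le (by positivity) (by positivity)
      ((le_add_of_nonneg_right (by positivity)).trans hratio) hratio (le_of_eq (by field_simp))
    refine hsec.mono (le_of_eq ?_)
    field_simp
    ring
  · set t := bidCeiling P RA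
    have ht : 0 < t := by linarith
    have hsq : (t - P) ^ 2 = 2 * t * RA := bidCeiling_sq hP hRA ht
    have hcost : t / 2 * (1 - t⁻¹ * P) ^ 2 = RA := by
      field_simp
      linarith
    have hsec := isSecuredByA_of_proportional (P := P) (RA := RA) (k := 1 - t⁻¹ * P) hτ hw hsum
      hRB.le ht (sub_nonneg.2 (inv_mul_le_one_of_le₀ (by linarith) ht.le))
      (sub_le_self _ (by positivity)) (by simp) (le_of_eq hcost)
    refine hsec.mono (le_of_eq ?_)
    field_simp
    ring

lemma mul_mem_preallocations (hw : ∀ b, 0 ≤ w b) (hsum : ∑ b, w b = 1) (hP : 0 ≤ P) :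
    (fun b => w b * P) ∈ preallocations n P :=
  ⟨fun b => mul_nonneg (hw b) hP, by rw [← Finset.sum_mul, hsum, one_mul]⟩

lemma IsSPEPayoffA.eq_lottoValue (hτ : ∀ b, τ b ∈ Set.Icc (0 : ℝ) 1) (hw : ∀ b, 0 < w b)
    (hsum : ∑ b, w b = 1) (hP : 0 ≤ P) (hRA : 0 ≤ RA) (hRB : 0 < RB)
    (h : IsSPEPayoffA τ w P RA RB v) : v = lottoValue P RA RB := by
  obtain ⟨pstar, FA, FB, ⟨hpstar, hnash, hopt⟩, rfl⟩ := h
  have hprop := mul_mem_preallocations (fun b => (hw b).le) hsum hP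
  refine ((hnash pstar hpstar).payoffA_le_lottoValue (fun b => (hτ b).2) hw hsum hP hRA hRB
    hpstar).antisymm ?_
  exact ((hnash _ hprop).le_payoffA
    (isSecuredByA_lottoValue (fun b => (hτ b).1) hw hsum hP hRA hRB)).trans (hopt _ hprop)

theorem isSPEPayoffA_lottoValue (hτ : ∀ b, τ b ∈ Set.Icc (0 : ℝ) 1) (hw : ∀ b, 0 < w b)
    (hsum : ∑ b, w b = 1) (hP : 0 ≤ P) (hRA : 0 ≤ RA) (hRB : 0 < RB)
    (h : 0 < RA ∨ P < RB ∨ τ = fun _ => 0) : IsSPEPayoffA τ w P RA RB (lottoValue P RA RB) := by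
  have hnash : ∀ p ∈ preallocations n P, ∃ FA FB, IsSubgameNash τ w p RA RB FA FB := by
    rintro p ⟨hp, rfl⟩
    exact exists_isSubgameNash_of_nonneg hτ hw (hsum ▸ one_pos) hp hRA hRB h
  choose! FA FB hnash using hnash
  have hprop := mul_mem_preallocations (fun b => (hw b).le) hsum hP
  have hsecured := (hnash _ hprop).le_payoffA
    (isSecuredByA_lottoValue (fun b => (hτ b).1) hw hsum hP hRA hRB)
  have hcapped := fun p hp => (hnash p hp).payoffA_le_lottoValue (fun b => (hτ b).2) hw hsum hP hRA
    hRB hp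
  exact ⟨_, FA, FB, ⟨hprop, hnash, fun p hp => (hcapped p hp).trans hsecured⟩,
    (hcapped _ hprop).antisymm hsecured⟩

end Equilibrium

section LevelCurve

variable {n : ℕ} {w : Fin n → ℝ} {P RA RB c v : ℝ}

lemma lottoValue_lt_one (hRA : 0 ≤ RA) (hRB : 0 < RB) : lottoValue P RA RB < 1 := by
  have hle := add_le_bidCeiling P RA
  unfold lottoValue
  split_ifs
  · exact (div_lt_one (by linarith)).2 (by linarith)
  · exact sub_lt_self _ (div_pos hRB (by linarith))

lemma lt_lottoValue_of_div_lt (hRA : 0 ≤ RA) (hRB : 0 < RB) (hc0 : 0 ≤ c) (hc : c < 1)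
    (hP : RB / (1 - c) < P) : c < lottoValue P RA RB := by
  have hle := add_le_bidCeiling P RA
  have hRBP : RB < P := (le_div_self hRB.le (by linarith) (by linarith)).trans_lt hP
  have hceil : RB / bidCeiling P RA < 1 - c :=
    (div_lt_comm₀ (sub_pos.2 hc) (by linarith)).1 (by linarith)
  rw [lottoValue, if_neg (by linarith)]
  linarith

lemma lottoValue_eq_iff (hRA : 0 ≤ RA) (hRB : 0 < RB) (hc : c < 1) :
    lottoValue P RA RB = c ↔
      (bidCeiling P RA + P < 2 * RB ∧ RA = 2 * c * (RB - P)) ∨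
        (2 * RB ≤ bidCeiling P RA + P ∧ bidCeiling P RA = RB / (1 - c)) := by
  have hle := add_le_bidCeiling P RA
  have hc' : 1 - c ≠ 0 := (sub_pos.2 hc).ne'
  unfold lottoValue
  split_ifs with hcase
  · rw [div_eq_iff (by linarith)]
    simp only [hcase, hcase.not_ge, true_and, false_and, or_false]
    rw [mul_comm 2 c, mul_assoc]
  · have hceil : bidCeiling P RA ≠ 0 := by linarith
    simp only [hcase, not_lt.1 hcase, true_and, false_and, false_or]
    rw [eq_div_iff hc', sub_eq_iff_eq_add, ← sub_eq_iff_eq_add', eq_div_iff hceil, mul_comm]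

lemma bidCeiling_add_lt_iff (hP : 0 ≤ P) (hRA : 0 ≤ RA) (hPRB : P < RB)
    (hRA_eq : RA = 2 * c * (RB - P)) :
    bidCeiling P RA + P < 2 * RB ↔ P * (1 - c) < (1 - 2 * c) * RB := by
  have hgap : 0 < 4 * (RB - P) := by linarith
  have hdiff : (2 * RB - P - P) ^ 2 - 2 * (2 * RB - P) * RA =
      4 * (RB - P) * ((1 - 2 * c) * RB - P * (1 - c)) := by
    rw [hRA_eq]
    ring
  rw [← lt_sub_iff_add_lt, bidCeiling_lt_iff hP hRA (by linarith), ← sub_pos, hdiff,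
    mul_pos_iff_of_pos_left hgap, sub_pos]

lemma bidCeiling_eq_div_iff (hP : 0 ≤ P) (hRA : 0 ≤ RA) (hRB : 0 < RB) (hc : c < 1) :
    bidCeiling P RA = RB / (1 - c) ↔
      P ≤ RB / (1 - c) ∧ RA = (RB - (1 - c) * P) ^ 2 / (2 * RB * (1 - c)) := by
  have hc' : 0 < 1 - c := sub_pos.2 hc
  have hT : 0 < RB / (1 - c) := by positivity
  have hsq : RA = (RB - (1 - c) * P) ^ 2 / (2 * RB * (1 - c)) ↔
      2 * (RB / (1 - c)) * RA = (RB / (1 - c) - P) ^ 2 := by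
    rw [eq_comm, ← mul_right_inj' (mul_pos two_pos hT).ne', eq_comm]
    congr! 1
    field_simp
  rw [hsq]
  exact ⟨fun h => have hPT : P ≤ RB / (1 - c) := h ▸ (by linarith [add_le_bidCeiling P RA])
    ⟨hPT, (bidCeiling_eq_iff hP hRA hT hPT).1 h⟩, fun h => (bidCeiling_eq_iff hP hRA hT h.1).2 h.2⟩

lemma levelFn_of_lt (hP : 0 ≤ P) (hRB : 0 < RB) (hc : c < 1)
    (h : P * (1 - c) < (1 - 2 * c) * RB) : levelFn RB c P = 2 * c * (RB - P) := by
  have hc' : 0 < 1 - c := sub_pos.2 hc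
  have hhalf : 0 < 1 - 2 * c :=
    pos_of_mul_pos_left ((mul_nonneg hP hc'.le).trans_lt h) hRB.le
  exact if_pos ⟨by linarith, (lt_div_iff₀ hc').2 h⟩

lemma levelFn_of_le (hc : c < 1) (h : (1 - 2 * c) * RB ≤ P * (1 - c)) :
    levelFn RB c P = (RB - (1 - c) * P) ^ 2 / (2 * RB * (1 - c)) :=
  if_neg fun hlt => h.not_gt ((lt_div_iff₀ (sub_pos.2 hc)).1 hlt.2)

lemma levelFn_nonneg (hRB : 0 < RB) (hc0 : 0 ≤ c) (hc : c < 1) : 0 ≤ levelFn RB c P := by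
  have hc' : 0 < 1 - c := sub_pos.2 hc
  unfold levelFn
  split_ifs with h
  · have hlt : P * (1 - c) < RB * (1 - c) :=
      ((lt_div_iff₀ hc').1 h.2).trans_le (by linarith [mul_nonneg hc0 hRB.le])
    exact mul_nonneg (by positivity) (sub_nonneg.2 (lt_of_mul_lt_mul_right hlt hc'.le).le)
  · positivity

lemma lottoValue_eq_iff_eq_levelFn (hP : 0 ≤ P) (hRA : 0 ≤ RA) (hRB : 0 < RB) (hc0 : 0 ≤ c)
    (hc : c < 1) :
    lottoValue P RA RB = c ↔ P ≤ RB / (1 - c) ∧ RA = levelFn RB c P := by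
  have hc' : 0 < 1 - c := sub_pos.2 hc
  have hle := add_le_bidCeiling P RA
  have hcRB : 0 ≤ c * RB := by positivity
  have htop : 2 * RB ≤ RB / (1 - c) + P ↔ (1 - 2 * c) * RB ≤ P * (1 - c) := by
    rw [← sub_le_iff_le_add, le_div_iff₀ hc']
    constructor <;> intro h <;> linarith
  rw [lottoValue_eq_iff hRA hRB hc]
  rcases lt_or_ge (P * (1 - c)) ((1 - 2 * c) * RB) with hlow | hhigh
  · have hPRB : P < RB := lt_of_mul_lt_mul_right (by linarith : P * (1 - c) < RB * (1 - c)) hc'.le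
    have hPT : P ≤ RB / (1 - c) := hPRB.le.trans (le_div_self hRB.le hc' (by linarith))
    rw [levelFn_of_lt hP hRB hc hlow]
    constructor
    · rintro (⟨-, hRA_eq⟩ | ⟨htotal, hceil⟩)
      · exact ⟨hPT, hRA_eq⟩
      · exact absurd (htop.1 (hceil ▸ htotal)) hlow.not_ge
    · rintro ⟨-, hRA_eq⟩
      exact .inl ⟨(bidCeiling_add_lt_iff hP hRA hPRB hRA_eq).2 hlow, hRA_eq⟩
  · rw [levelFn_of_le hc hhigh, ← bidCeiling_eq_div_iff hP hRA hRB hc]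
    constructor
    · rintro (⟨htotal, hRA_eq⟩ | ⟨-, hceil⟩)
      · exact absurd ((bidCeiling_add_lt_iff hP hRA (by linarith) hRA_eq).1 htotal) hhigh.not_gt
      · exact hceil
    · exact fun hceil => .inr ⟨hceil ▸ htop.2 hhigh, hceil⟩

lemma isSPEPayoffA_iff_eq_lottoValue (hw : ∀ b, 0 < w b) (hsum : ∑ b, w b = 1) (hP : 0 ≤ P)
    (hRA : 0 ≤ RA) (hRB : 0 < RB) :
    IsSPEPayoffA (fun _ => 0) w P RA RB v ↔ v = lottoValue P RA RB :=
  ⟨fun h => h.eq_lottoValue (by simp) hw hsum hP hRA hRB,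
    fun h => h ▸ isSPEPayoffA_lottoValue (by simp) hw hsum hP hRA hRB (.inr (.inr rfl))⟩

lemma levelCurve_eq_graph_levelFn (hw : ∀ b, 0 < w b) (hsum : ∑ b, w b = 1) (hRB : 0 < RB)
    (hc0 : 0 ≤ c) (hc : c < 1) : levelCurve (fun _ => 0) w RB c =
      {q | ∃ P ∈ Set.Icc (0 : ℝ) (RB / (1 - c)), q = (P, levelFn RB c P)} := by
  ext ⟨P, RA⟩
  simp only [levelCurve, Set.mem_ofPred_eq, Prod.mk.injEq]
  constructor
  · rintro ⟨hP, hRA, hspe⟩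
    rw [isSPEPayoffA_iff_eq_lottoValue hw hsum hP hRA hRB, eq_comm,
      lottoValue_eq_iff_eq_levelFn hP hRA hRB hc0 hc] at hspe
    exact ⟨P, ⟨hP, hspe.1⟩, rfl, hspe.2⟩
  · rintro ⟨P, ⟨hP, hPT⟩, rfl, rfl⟩
    have hRA : 0 ≤ levelFn RB c P := levelFn_nonneg hRB hc0 hc
    exact ⟨hP, hRA, (isSPEPayoffA_iff_eq_lottoValue hw hsum hP hRA hRB).2
      ((lottoValue_eq_iff_eq_levelFn hP hRA hRB hc0 hc).2 ⟨hPT, rfl⟩).symm⟩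

end LevelCurve

theorem mainTheorem5 {n : ℕ} (w : Fin n → ℝ) (hw : ∀ b, 0 < w b) (hsum : ∑ b, w b = 1)
    (RB : ℝ) (hRB : 0 < RB) (c : ℝ) (hc : c ∈ Set.Icc (0 : ℝ) 1) :
    -- the equilibrium payoff is well defined for all endowments (ties won by player `B`)
    (∀ P RA : ℝ, 0 ≤ P → 0 ≤ RA → ∃! v : ℝ, IsSPEPayoffA (fun _ => 0) w P RA RB v) ∧
    -- the level curve
    (c < 1 → levelCurve (fun _ => 0) w RB c =
      {q | ∃ P ∈ Set.Icc (0 : ℝ) (RB / (1 - c)), q = (P, levelFn RB c P)}) ∧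
    (c < 1 → ∀ P RA v : ℝ, RB / (1 - c) < P → 0 ≤ RA →
      IsSPEPayoffA (fun _ => 0) w P RA RB v → c < v) ∧
    (c = 1 → levelCurve (fun _ => 0) w RB c = ∅) ∧
    -- the tie-breaking rule is immaterial
    (∀ τ : Fin n → ℝ, (∀ b, τ b ∈ Set.Icc (0 : ℝ) 1) → ∀ P RA : ℝ, 0 ≤ P → 0 ≤ RA →
      ((0 < RA ∨ P < RB) → ∃ v : ℝ, IsSPEPayoffA τ w P RA RB v) ∧
      (∀ v : ℝ, IsSPEPayoffA τ w P RA RB v → IsSPEPayoffA (fun _ => 0) w P RA RB v)) := by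
  have hspe : ∀ {P RA v : ℝ}, 0 ≤ P → 0 ≤ RA →
      (IsSPEPayoffA (fun _ => 0) w P RA RB v ↔ v = lottoValue P RA RB) := fun hP hRA =>
    isSPEPayoffA_iff_eq_lottoValue hw hsum hP hRA hRB
  refine ⟨fun P RA hP hRA => ?_, levelCurve_eq_graph_levelFn hw hsum hRB hc.1, ?_, ?_, ?_⟩
  · simp only [hspe hP hRA, existsUnique_eq]
  · intro hc1 P RA v hlt hRA hv
    have hP : 0 ≤ P := (div_nonneg hRB.le (sub_nonneg.2 hc.2)).trans hlt.le
    rw [(hspe hP hRA).1 hv]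
    exact lt_lottoValue_of_div_lt hRA hRB hc.1 hc1 hlt
  · rintro rfl
    exact Set.eq_empty_of_forall_notMem fun q ⟨hP, hRA, hone⟩ =>
      (lottoValue_lt_one hRA hRB).ne' ((hspe hP hRA).1 hone)
  · intro τ hτ P RA hP hRA
    exact ⟨fun h => ⟨_, isSPEPayoffA_lottoValue hτ hw hsum hP hRA hRB (h.imp_right .inl)⟩,
      fun v hv => (hspe hP hRA).2 (hv.eq_lottoValue hτ hw hsum hP hRA hRB)⟩
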